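/- Let $G$ be a finite connected simple graph with a root vertex $u$, let $n$ be a natural number, and let $\alpha\in[0,1)$. A partition of $n$ is a nondecreasing sequence $\mathbf a=(a_1,\dots,a_k)$ of positive integers with sum $n$; its length is $k$. For partitions $\mathbf a=(a_1,\dots,a_k)$ and $\mathbf b=(b_1,\dots,b_p)$ of $n$, $\mathbf a$ precedes $\mathbf b$ in shortlex order if either $k<p$, or $k=p$ and $a_i<b_i$ at the smallest index $i$ at which they differ. Let $G(\mathbf a,u)$ be the graph obtained from $G$ by attaching at $u$, for each $i=1,\dots,k$, a pendant path with $a_i$ edges (and $a_i$ new vertices). For a finite graph $H$ with diagonal degree matrix $D(H)$ and adjacency matrix $A(H)$, let $\rho_\alpha(H)$ be the spectral radius (that is, the largest eigenvalue) of $A_\alpha(H)=\alpha D(H)+(1-\alpha)A(H)$. Let $\mathbf a,\mathbf b$ be partitions of $n$ such that $\mathbf a$ precedes $\mathbf b$ in shortlex order. Then $$\rho_\alpha(G(\mathbf a,u))\le\rho_\alpha(G(\mathbf b,u)).$$ Equality holds if and only if $G(\mathbf a,u)$ and $G(\mathbf b,u)$ are isomorphic, and this happens if and only if $G=K_1$ (a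 single vertex) and $\mathbf b$ has length $2$. -/

import Mathlib

/-- The elements of `𝒫(n)`: nondecreasing sequences of positive integers with sum `n`. -/
def IsPartition (n : ℕ) (a : List ℕ) : Prop :=
  a.Pairwise (· ≤ ·) ∧ (∀ x ∈ a, 0 < x) ∧ a.sum = n

/-- The vertices of `G(a, u)`: those of `G`, and for each index `i` of the list `a` the `a[i]` new
vertices of the `i`-th path. The new vertex `Sum.inr ⟨i, j⟩` is at distance `j + 1` from `u`. -/
abbrev AttachVert (V : Type*) (a : List ℕ) : Type _ :=
  V ⊕ (Σ i : Fin a.length, Fin (a.get i))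

/-- Adjacency in `G(a, u)`. -/
def AttachAdj {V : Type*} (G : SimpleGraph V) (u : V) (a : List ℕ) :
    AttachVert V a → AttachVert V a → Prop
  | Sum.inl x, Sum.inl y => G.Adj x y
  | Sum.inl x, Sum.inr q => x = u ∧ (q.2 : ℕ) = 0
  | Sum.inr p, Sum.inl y => y = u ∧ (p.2 : ℕ) = 0
  | Sum.inr p, Sum.inr q =>
      p.1 = q.1 ∧ ((p.2 : ℕ) + 1 = (q.2 : ℕ) ∨ (q.2 : ℕ) + 1 = (p.2 : ℕ))

/-- The graph `G(a, u)` obtained from `G` by attaching at the vertex `u`, for each entry `k` of the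
list `a`, a pendant path of length `k` (that is, with `k` edges and `k` new vertices). -/
def attachPaths {V : Type*} (G : SimpleGraph V) (u : V) (a : List ℕ) :
    SimpleGraph (AttachVert V a) where
  Adj := AttachAdj G u a
  symm := ⟨by
    rintro (x | p) (y | q) h
    · exact G.adj_symm h
    · exact h
    · exact h
    · exact ⟨h.1.symm, h.2.symm⟩⟩
  loopless := ⟨by
    rintro (x | p) h
    · exact G.irrefl h
    · rcases h.2 with h | h <;> omega⟩

open Classical in
/-- The matrix `A_α(G) = α D(G) + (1 - α) A(G)`, where `D(G)` is the diagonal matrix of the vertex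
degrees and `A(G)` is the adjacency matrix. -/
noncomputable def alphaMatrix {V : Type*} [Fintype V] (G : SimpleGraph V) (α : ℝ) :
    Matrix V V ℝ :=
  α • G.degMatrix ℝ + (1 - α) • G.adjMatrix ℝ

open Classical in
/-- The spectral radius `ρ_α(G)`: the largest eigenvalue of the real symmetric matrix `A_α(G)`. -/
noncomputable def rhoAlpha {V : Type*} [Fintype V] (α : ℝ) (G : SimpleGraph V) : ℝ :=
  sSup (spectrum ℝ (alphaMatrix G α))

theorem alphaMatrix_isHermitian {V : Type*} [Fintype V] (G : SimpleGraph V) (α : ℝ) :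
    (alphaMatrix G α).IsHermitian := by
  classical
  ext i j
  simp only [alphaMatrix, SimpleGraph.degMatrix, Matrix.conjTranspose_apply, Matrix.add_apply,
    Matrix.smul_apply, Matrix.diagonal_apply, SimpleGraph.adjMatrix_apply, star_trivial,
    G.adj_comm j i]
  by_cases h : i = j
  · subst h; rfl
  · simp [h, Ne.symm h]

open Classical in
/-- The supremum in `rhoAlpha` is attained: `rhoAlpha α G` is the greatest eigenvalue. -/
theorem isGreatest_rhoAlpha {V : Type*} [Fintype V] [Nonempty V] (α : ℝ) (G : SimpleGraph V) :
    IsGreatest (spectrum ℝ (alphaMatrix G α)) (rhoAlpha α G) := by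
  have hs := (alphaMatrix_isHermitian G α).spectrum_real_eq_range_eigenvalues
  have hf : (spectrum ℝ (alphaMatrix G α)).Finite := by
    rw [hs]; exact Set.finite_range _
  have hn : (spectrum ℝ (alphaMatrix G α)).Nonempty := by
    rw [hs]; exact Set.range_nonempty _
  exact ⟨hn.csSup_mem hf, fun x hx => le_csSup hf.bddAbove hx⟩

/-! Fix ρ and put β = α/(1-α), c = (ρ-2α)/(1-α). Along a pendant path a positive eigenvector
satisfies x (j-1) + x (j+1) = c * x j, so its successive ratios are determined from the free end by
the continued fraction `legRatio`. Seen from u, a path of length s is just a diagonal term (1-α) *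
`legWeight β c s`. Let F(a) be the sum of the weights of the parts of a.

Suppose ρ = ρ_α(G(a,u)) ≥ ρ_α(G(b,u)). The two Perron vectors restrict to G as a solution with
diagonal term F(a) and a supersolution with F(b); pairing them through the symmetric matrix gives
F(b) ≤ F(a) (`le_of_solution_of_supersolution`).

The contradiction is F(a) < F(b), from `sum_legWeight_lt`. Length 0 has weight 0, so a may be padded
with zeros; after cancelling a common part, both sides have equally many parts and equal sums, and a
has the smaller minimum. If the longest part of a does not exceed that of b, `legWeight_add_sum_lt`
decides. Otherwise edges are shifted to the longest part of b, which lowers F(b)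
(`legWeight_pred_add_succ_lt`), until the first case applies or a common part cancels.

The equation at u gives F ≤ c + 2β. A shift needs the two paths involved to lie strictly below this
bound, which can fail only for K_1 with two paths; there both graphs are paths. -/

/-- The ratios `x j / x (j + 1)` of consecutive entries of an eigenvector along a pendant path, read
from the free end, as a function of `β = α / (1 - α)` and `c = (ρ - 2 α) / (1 - α)`. -/
noncomputable def legRatio (β c : ℝ) : ℕ → ℝ
  -- The free-end equation x 1 = (c + β) * x 0 is the interior recursion with a fictitious preceding
  -- entry -β * x 0.
  | 0 => -β
  | s + 1 => (c - legRatio β c s)⁻¹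

/-- The normalized contribution of a pendant path of length `s` to the eigenvalue equation at the
vertex to which it is attached. -/
noncomputable def legWeight (β c : ℝ) (s : ℕ) : ℝ := β + legRatio β c s

/-- The recursion for `legRatio` has positive denominators up to index `N`. -/
def LegValid (β c : ℝ) (N : ℕ) : Prop := ∀ s < N, 0 < c - legRatio β c s

/-! ### Monotonicity and exchange estimates for path weights -/

section LegRatio

variable {β c : ℝ} {N : ℕ}

theorem LegValid.mono {M : ℕ} (h : LegValid β c N) (hM : M ≤ N) : LegValid β c M :=
  fun s hs => h s (hs.trans_le hM)

theorem LegValid.legRatio_pos (h : LegValid β c N) {s : ℕ} (hs : 0 < s) (hsN : s ≤ N) :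
    0 < legRatio β c s := by
  obtain ⟨s, rfl⟩ := Nat.exists_eq_succ_of_ne_zero hs.ne'
  exact inv_pos.2 (h s hsN)

theorem LegValid.legRatio_lt_succ (hβ : 0 ≤ β) {s : ℕ} (h : LegValid β c (s + 1)) :
    legRatio β c s < legRatio β c (s + 1) := by
  induction s with
  | zero =>
    have := h.legRatio_pos one_pos le_rfl
    simp only [legRatio] at this ⊢
    linarith
  | succ s ih =>
    have h1 := ih (h.mono (Nat.le_succ _))
    change (c - legRatio β c s)⁻¹ < (c - legRatio β c (s + 1))⁻¹
    exact inv_strictAnti₀ (h (s + 1) (Nat.lt_succ_self _)) (by linarith)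

theorem LegValid.legRatio_lt (hβ : 0 ≤ β) (h : LegValid β c N) {s r : ℕ} (hsr : s < r)
    (hr : r ≤ N) : legRatio β c s < legRatio β c r := by
  induction r, hsr using Nat.le_induction with
  | base => exact LegValid.legRatio_lt_succ hβ (h.mono hr)
  | succ r _ ih =>
    exact (ih (Nat.le_of_succ_le hr)).trans (LegValid.legRatio_lt_succ hβ (h.mono hr))

theorem LegValid.legWeight_lt (hβ : 0 ≤ β) (h : LegValid β c N) {s r : ℕ} (hsr : s < r)
    (hr : r ≤ N) : legWeight β c s < legWeight β c r :=
  add_lt_add_right (h.legRatio_lt hβ hsr hr) β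

theorem LegValid.legWeight_le (hβ : 0 ≤ β) (h : LegValid β c N) {s r : ℕ} (hsr : s ≤ r)
    (hr : r ≤ N) : legWeight β c s ≤ legWeight β c r := by
  rcases hsr.eq_or_lt with rfl | hlt
  · exact le_rfl
  · exact (h.legWeight_lt hβ hlt hr).le

@[simp]
theorem legWeight_zero : legWeight β c 0 = 0 := by simp [legWeight, legRatio]

theorem LegValid.legWeight_nonneg (hβ : 0 ≤ β) (h : LegValid β c N) {s : ℕ} (hs : s ≤ N) :
    0 ≤ legWeight β c s := by
  simpa using h.legWeight_le hβ (Nat.zero_le s) hs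

theorem LegValid.legWeight_pos (hβ : 0 ≤ β) (h : LegValid β c N) {s : ℕ} (hs0 : 0 < s)
    (hs : s ≤ N) : 0 < legWeight β c s := by
  simpa using h.legWeight_lt hβ hs0 hs

/-- τ is a fixed point of the increasing map r ↦ (c - r)⁻¹, and the iteration starts at -β < τ. -/
theorem legRatio_lt_of_add_inv_eq (hβ : 0 ≤ β) {τ : ℝ} (hτ : 0 < τ) (hc : τ + τ⁻¹ = c) (s : ℕ) :
    legRatio β c s < τ := by
  induction s with
  | zero => simp only [legRatio]; linarith
  | succ s ih =>
    have h1 : τ⁻¹ < c - legRatio β c s := by linarith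
    simpa [legRatio] using inv_strictAnti₀ (inv_pos.2 hτ) h1

theorem sub_legRatio_succ (hβ : 0 ≤ β) {τ : ℝ} (hτ : 0 < τ) (hc : τ + τ⁻¹ = c) (s : ℕ) :
    τ - legRatio β c (s + 1) = (τ - legRatio β c s) * (τ * legRatio β c (s + 1)) := by
  have h1 := legRatio_lt_of_add_inv_eq hβ hτ hc s
  have h2 : 0 < c - legRatio β c s := by
    have := inv_pos.2 hτ
    linarith
  simp only [legRatio]
  have h3 : τ * (c - legRatio β c s) = 1 + (τ - legRatio β c s) * τ := by
    rw [← hc]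
    field_simp
    ring
  generalize c - legRatio β c s = D at *
  field_simp
  linarith

/-- If two pendant paths stay below the eigenvalue bound, then the longer of them may be extended
by one edge. -/
theorem legValid_succ_of_add_lt {y v : ℕ} (hy : 0 < y) (hyv : y ≤ v)
    (hv : LegValid β c v)
    (hsum : legWeight β c y + legWeight β c v < c + 2 * β) : LegValid β c (v + 1) := by
  intro s hs
  rcases (Nat.lt_succ_iff.1 hs).eq_or_lt with rfl | hlt
  · unfold legWeight at hsum
    have := hv.legRatio_pos hy hyv
    linarith
  · exact hv s hlt

/-- Moving an edge from a shorter pendant path to a longer one decreases the total weight. -/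
theorem legWeight_pred_add_succ_lt (hβ : 0 ≤ β) {y v : ℕ} (hyv : y + 1 ≤ v) (hv : LegValid β c v)
    (hsum : legWeight β c (y + 1) + legWeight β c v < c + 2 * β) :
    legWeight β c y + legWeight β c (v + 1) < legWeight β c (y + 1) + legWeight β c v := by
  have hv1 := legValid_succ_of_add_lt (Nat.succ_pos _) hyv hv hsum
  have hQ : 0 < legRatio β c (y + 1) := hv.legRatio_pos (Nat.succ_pos _) hyv
  have hlt : legRatio β c (y + 1) < legRatio β c (v + 1) :=
    hv1.legRatio_lt hβ (Nat.lt_succ_of_le hyv) le_rfl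
  have hA : 0 < c - legRatio β c v := hv1 v (Nat.lt_succ_self _)
  -- With Q = `legRatio β c (y + 1)` and A = c - `legRatio β c v`, the claim becomes A + A⁻¹ < Q +
  -- Q⁻¹. It holds because Q < A (eigenvalue bound) and A < Q⁻¹ (monotonicity).
  have hy : legRatio β c y = c - (legRatio β c (y + 1))⁻¹ := by
    simp [legRatio]
  have hAQ : legRatio β c (y + 1) < c - legRatio β c v := by
    unfold legWeight at hsum; linarith
  have hv' : legRatio β c (v + 1) = (c - legRatio β c v)⁻¹ := rfl
  unfold legWeight
  rw [hy]
  rw [hv'] at hlt ⊢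
  have hcv : legRatio β c v = c - (c - legRatio β c v) := by ring
  generalize c - legRatio β c v = A at *
  generalize legRatio β c (y + 1) = Q at *
  rw [hcv]
  have hQA : Q * A < 1 := by
    calc Q * A < A⁻¹ * A := mul_lt_mul_of_pos_right hlt hA
      _ = 1 := inv_mul_cancel₀ hA.ne'
  have key : Q + Q⁻¹ - (A + A⁻¹) = (A - Q) * (1 - Q * A) / (Q * A) := by
    field_simp
    ring
  have : 0 < (A - Q) * (1 - Q * A) / (Q * A) := by
    apply div_pos (mul_pos (by linarith) (by linarith)) (mul_pos hQ hA)
  linarith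

/-- The main estimate: `M` paths of length `x + 1` weigh more than one path of length `x` together
with `M - 1` paths each of weight at most `w`, provided that the latter paths and one more of
weight `w` satisfy the eigenvalue bound. -/
theorem legWeight_add_sum_lt (hβ : 0 ≤ β) {x w : ℕ} {s : Multiset ℕ} (hxw : x < w)
    (hw : LegValid β c w) (hs : ∀ y ∈ s, y ≤ w)
    (hsum : legWeight β c x + (s.map (legWeight β c)).sum + legWeight β c w ≤ c + 2 * β) :
    legWeight β c x + (s.map (legWeight β c)).sum
      < (s.card + 1 : ℕ) * legWeight β c (x + 1) := by
  have hq : 0 < legRatio β c (x + 1) := hw.legRatio_pos (Nat.succ_pos _) hxw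
  have hx : legRatio β c x = c - (legRatio β c (x + 1))⁻¹ := by simp [legRatio]
  have hlt : legWeight β c x < legWeight β c (x + 1) :=
    hw.legWeight_lt hβ (Nat.lt_succ_self x) hxw
  rcases s.empty_or_exists_mem with rfl | ⟨z, hz⟩
  · simpa using hlt
  have hcard : 0 < s.card := Multiset.card_pos.2 (fun h => by simp [h] at hz)
  set m : ℕ := s.card with hm
  set W : ℝ := (s.map (legWeight β c)).sum with hW
  have hWw : W ≤ m * legWeight β c w := by
    have := Multiset.sum_le_card_nsmul (s.map (legWeight β c)) (legWeight β c w) (by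
      intro y hy
      obtain ⟨i, hi, rfl⟩ := Multiset.mem_map.1 hy
      exact hw.legWeight_le hβ (hs i hi) le_rfl)
    simpa using this
  push_cast
  have hm0 : (0 : ℝ) < m := by exact_mod_cast hcard
  set q := legRatio β c (x + 1) with hqdef
  -- The quadratic case.
  by_cases hquad : 0 < ((m + 1 : ℝ) * q) ^ 2 - c * ((m + 1) * q) + 1
  · have h1 : 0 < (m + 1 : ℝ) ^ 2 * q + q⁻¹ - (m + 1) * c := by
      have : (m + 1 : ℝ) ^ 2 * q + q⁻¹ - (m + 1) * c
          = (((m + 1 : ℝ) * q) ^ 2 - c * ((m + 1) * q) + 1) / q := by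
        field_simp
        ring
      rw [this]
      exact div_pos hquad hq
    -- Substituting c - q⁻¹ for the ratio at x turns this into `h1` with the extra nonnegative term
    -- β * m ^ 2.
    have h2 : m * (c + 2 * β) + legWeight β c x < (m + 1 : ℝ) ^ 2 * legWeight β c (x + 1) := by
      unfold legWeight
      rw [hx, ← hqdef]
      have : (0 : ℝ) ≤ β * m ^ 2 := by positivity
      nlinarith
    -- Add m times the eigenvalue bound to `hWw`; the weight of w cancels.
    have h3 : (m + 1 : ℝ) * (legWeight β c x + W) < (m + 1) * ((m + 1) * legWeight β c (x + 1)) := by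
      nlinarith [mul_le_mul_of_nonneg_left hsum hm0.le]
    exact lt_of_mul_lt_mul_left h3 (by positivity)
  · -- Here `c ≥ 2`, so all ratios are bounded by the smaller root of `τ + τ⁻¹ = c`.
    push Not at hquad
    set p := (m + 1 : ℝ) * q with hp
    have hp0 : 0 < p := by positivity
    have hc2 : 2 ≤ c := by
      by_contra hcon
      push Not at hcon
      nlinarith [sq_nonneg (p - 1)]
    have hD : 0 ≤ c ^ 2 - 4 := by nlinarith
    set S := √(c ^ 2 - 4) with hS
    have hSS : S ^ 2 = c ^ 2 - 4 := Real.sq_sqrt hD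
    have hS0 : 0 ≤ S := Real.sqrt_nonneg _
    have hSc : S < c := by nlinarith
    have hτ : 0 < (c - S) / 2 := by linarith
    have hinv : ((c - S) / 2)⁻¹ = (c + S) / 2 := by
      rw [inv_eq_iff_eq_inv, eq_comm]
      apply inv_eq_of_mul_eq_one_left
      nlinarith
    have hτc : (c - S) / 2 + ((c - S) / 2)⁻¹ = c := by rw [hinv]; ring
    -- p lies between the roots of t ^ 2 - c * t + 1, whose product is 1.
    have hpt : (c - S) / 2 * p ≤ 1 := by
      have h1 : p ≤ (c + S) / 2 := by
        by_contra hcon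
        push Not at hcon
        nlinarith [mul_pos (show 0 < p - (c + S) / 2 by linarith)
          (show 0 < p - (c - S) / 2 by linarith)]
      calc (c - S) / 2 * p ≤ (c - S) / 2 * ((c + S) / 2) := by gcongr
        _ = 1 := by nlinarith
    have hlim := legRatio_lt_of_add_inv_eq hβ hτ hτc
    have hsub := sub_legRatio_succ hβ hτ hτc x
    set τ := (c - S) / 2 with hτdef
    have hWτ : W < m * (β + τ) := by
      have hlt' : W < (s.map fun _ => β + τ).sum := by
        apply Multiset.sum_lt_sum
        · intro i _
          exact add_le_add_right (hlim i).le β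
        · exact ⟨z, hz, add_lt_add_right (hlim z) β⟩
      simpa [mul_add] using hlt'
    -- By `hsub` the left side is the right side times τ * p, and τ * p ≤ 1.
    have h4 : (m + 1 : ℝ) * (τ - q) ≤ τ - legRatio β c x := by
      rw [hsub]
      have : 0 ≤ τ - legRatio β c x := by linarith [hlim x]
      nlinarith [mul_nonneg this (show 0 ≤ 1 - τ * p by linarith)]
    unfold legWeight
    rw [← hqdef]
    nlinarith

end LegRatio

/-! ### Comparing total weights of multisets of path lengths -/

section LegWeightSum

variable {β c : ℝ}

theorem sum_legWeight_nonneg (hβ : 0 ≤ β) {s : Multiset ℕ} (hs : ∀ y ∈ s, LegValid β c y) :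
    0 ≤ (s.map (legWeight β c)).sum := by
  apply Multiset.sum_nonneg
  intro y hy
  obtain ⟨i, hi, rfl⟩ := Multiset.mem_map.1 hy
  exact (hs i hi).legWeight_nonneg hβ le_rfl

theorem sum_legWeight_pos (hβ : 0 ≤ β) {s : Multiset ℕ} (hs : ∀ y ∈ s, LegValid β c y)
    {z : ℕ} (hz : z ∈ s) (hz0 : 0 < z) : 0 < (s.map (legWeight β c)).sum := by
  obtain ⟨t, rfl⟩ := Multiset.exists_cons_of_mem hz
  have h1 := sum_legWeight_nonneg hβ fun y hy => hs y (Multiset.mem_cons_of_mem hy)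
  have h2 := (hs z hz).legWeight_pos hβ hz0 le_rfl
  simp only [Multiset.map_cons, Multiset.sum_cons]
  linarith

/-- Of two multisets of path lengths with equal sizes and equal sums, the one with the larger
minimum has the larger total weight, as long as both satisfy the eigenvalue bound. -/
theorem sum_legWeight_lt (hβ : 0 ≤ β) {x : ℕ} {a b : Multiset ℕ} (hcard : a.card = b.card)
    (hsum : a.sum = b.sum) (hxa : x ∈ a) (hax : ∀ y ∈ a, x ≤ y) (hbx : ∀ y ∈ b, x < y)
    (hva : ∀ y ∈ a, LegValid β c y) (hvb : ∀ y ∈ b, LegValid β c y)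
    (hFa : (a.map (legWeight β c)).sum ≤ c + 2 * β)
    (hFb : (b.map (legWeight β c)).sum ≤ c + 2 * β)
    (hstrict : 3 ≤ b.card ∨ (b.map (legWeight β c)).sum < c + 2 * β) :
    (a.map (legWeight β c)).sum < (b.map (legWeight β c)).sum := by
  induction hm : b.card generalizing a b with
  | zero =>
    rw [hm, Multiset.card_eq_zero] at hcard
    simp [hcard] at hxa
  | succ m ihm =>
  obtain ⟨a, rfl⟩ := Multiset.exists_cons_of_mem hxa
  have hb0 : b ≠ 0 := by rintro rfl; simp at hm
  have ha0 : a ≠ 0 := by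
    rintro rfl
    rw [Multiset.card_cons, Multiset.card_zero, zero_add] at hcard
    obtain ⟨y, rfl⟩ := Multiset.card_eq_one.1 hcard.symm
    have := hbx y (by simp)
    simp at hsum
    omega
  obtain ⟨w, hwa, hw⟩ := Multiset.exists_max_image id ha0
  obtain ⟨a, rfl⟩ := Multiset.exists_cons_of_mem hwa
  obtain ⟨v, hvb', hv⟩ := Multiset.exists_max_image id hb0
  obtain ⟨b, rfl⟩ := Multiset.exists_cons_of_mem hvb'
  -- Otherwise every part of a is at most x, too small for a sum equal to that of b.
  have hxw : x < w := by
    by_contra hcon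
    have h1 := Multiset.sum_le_card_nsmul (w ::ₘ a) x (fun y hy => by
      have := hw y hy
      simp only [id] at this
      omega)
    have h2 := Multiset.card_nsmul_le_sum (s := v ::ₘ b) (a := x + 1) (fun y hy => hbx y hy)
    simp only [Multiset.card_cons, Multiset.sum_cons, smul_eq_mul] at h1 h2 hsum hcard hm
    rw [← hcard] at h2
    nlinarith
  have hvw := hva w (by simp)
  have hwa' : ∀ y ∈ a, y ≤ w := fun y hy => hw y (Multiset.mem_cons_of_mem hy)
  have hv' : ∀ y ∈ b, y ≤ v := fun y hy => hv y (Multiset.mem_cons_of_mem hy)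
  clear hw hv hwa hvb' hb0 ha0
  -- The inner induction is on the truncated gap w - v; at zero the longest part of b is at least w.
  have hd : w ≤ v + (w - v) := by omega
  generalize w - v = d at hd
  simp only [Multiset.card_cons, Multiset.sum_cons, Multiset.map_cons] at *
  induction d generalizing v b with
  | zero =>
    have hvv := hvb v (by simp)
    -- Match v against w; the other parts of b, all at least x + 1, outweigh x and the rest of a.
    have h1 := legWeight_add_sum_lt hβ hxw hvw hwa' (by linarith)
    have h2 := Multiset.card_nsmul_le_sum (s := b.map (legWeight β c))
      (a := legWeight β c (x + 1)) (by
        intro y hy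
        obtain ⟨i, hi, rfl⟩ := Multiset.mem_map.1 hy
        exact (hvb i (by simp [hi])).legWeight_le hβ (hbx i (by simp [hi])) le_rfl)
    have h3 := hvv.legWeight_le hβ (show w ≤ v by omega) le_rfl
    have h4 : b.card = a.card + 1 := by omega
    rw [Multiset.card_map, h4, nsmul_eq_mul] at h2
    linarith
  | succ d ihd =>
    rcases Nat.lt_or_ge (v + d) w with hlt | hge
    swap
    · exact ihd v b hbx hvb hv' hge hFb hstrict hm hcard hsum
    have hvv := hvb v (by simp)
    -- Strictness comes from a third path of positive weight or from the strict bound.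
    have hpos : ∀ y ∈ b, ∀ t, b = y ::ₘ t →
        legWeight β c y + legWeight β c v < c + 2 * β ∧ 0 ≤ (t.map (legWeight β c)).sum := by
      rintro y hy t rfl
      have ht : ∀ z ∈ t, LegValid β c z := fun z hz => hvb z (by simp [hz])
      have h0 := sum_legWeight_nonneg hβ ht
      simp only [Multiset.card_cons, Multiset.map_cons, Multiset.sum_cons] at hstrict hFb
      refine ⟨?_, h0⟩
      rcases hstrict with h3 | h3
      · obtain ⟨z, hz⟩ := Multiset.card_pos_iff_exists_mem.1 (show 0 < t.card by omega)
        have := sum_legWeight_pos hβ ht hz (pos_of_gt (hbx z (by simp [hz])))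
        linarith
      · linarith
    by_cases hex : ∃ y ∈ b, x + 1 < y
    · obtain ⟨y, hy, hxy⟩ := hex
      obtain ⟨t, rfl⟩ := Multiset.exists_cons_of_mem hy
      obtain ⟨y, rfl⟩ : ∃ y', y = y' + 1 := ⟨y - 1, by omega⟩
      obtain ⟨hlt1, ht0⟩ := hpos _ hy t rfl
      have hyv : y + 1 ≤ v := hv' _ hy
      have hmove := legWeight_pred_add_succ_lt hβ hyv hvv hlt1
      have hvv1 := legValid_succ_of_add_lt (Nat.succ_pos _) hyv hvv hlt1
      simp only [Multiset.card_cons, Multiset.map_cons, Multiset.sum_cons] at *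
      -- One edge moves from y + 1 to v. The weight drops, so the strict alternative holds from now
      -- on.
      refine (ihd (v + 1) (y ::ₘ t) ?_ ?_ ?_ ?_ ?_ (Or.inr ?_) ?_ ?_ ?_).trans ?_
      · intro z hz
        simp only [Multiset.mem_cons] at hz
        rcases hz with rfl | rfl | hz
        · omega
        · omega
        · exact hbx z (by simp [hz])
      · intro z hz
        simp only [Multiset.mem_cons] at hz
        rcases hz with rfl | rfl | hz
        · exact hvv1
        · exact hvv1.mono (by omega)
        · exact hvb z (by simp [hz])
      · intro z hz
        rcases Multiset.mem_cons.1 hz with rfl | hz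
        · omega
        · exact (hv' z (by simp [hz])).trans (Nat.le_succ v)
      · omega
      · simp only [Multiset.map_cons, Multiset.sum_cons]; linarith
      · simp only [Multiset.map_cons, Multiset.sum_cons]; linarith
      · simpa using hm
      · simpa using hcard
      · simp only [Multiset.sum_cons]; omega
      · simp only [Multiset.map_cons, Multiset.sum_cons]; linarith
    · push Not at hex
      -- Now every other part of b is x + 1, so a shift creates a part x, which cancels against the
      -- x in a.
      have hb1 : ∀ y ∈ b, y = x + 1 := fun y hy =>
        le_antisymm (hex y hy) (hbx y (by simp [hy]))
      obtain ⟨y, hy⟩ := Multiset.card_pos_iff_exists_mem.1 (show 0 < b.card by omega)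
      obtain rfl := hb1 y hy
      obtain ⟨t, rfl⟩ := Multiset.exists_cons_of_mem hy
      obtain ⟨hlt1, ht0⟩ := hpos _ hy t rfl
      have hyv : x + 1 ≤ v := hv' _ hy
      have hmove := legWeight_pred_add_succ_lt hβ hyv hvv hlt1
      have hvv1 := legValid_succ_of_add_lt (Nat.succ_pos _) hyv hvv hlt1
      have hx0 := hvw.legWeight_nonneg hβ hxw.le
      simp only [Multiset.card_cons, Multiset.map_cons, Multiset.sum_cons] at *
      suffices h : legWeight β c w + (a.map (legWeight β c)).sum
          ≤ legWeight β c (v + 1) + (t.map (legWeight β c)).sum by linarith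
      by_cases hxa' : x ∈ a
      · have := @ihm (w ::ₘ a) ((v + 1) ::ₘ t) (by simp; omega) (by simp; omega) (by simp [hxa'])
          (fun z hz => hax z (Multiset.mem_cons_of_mem hz))
          (by
            intro z hz
            rcases Multiset.mem_cons.1 hz with rfl | hz
            · omega
            · exact hbx z (by simp [hz]))
          (fun z hz => hva z (Multiset.mem_cons_of_mem hz))
          (by
            intro z hz
            rcases Multiset.mem_cons.1 hz with rfl | hz
            · exact hvv1
            · exact hvb z (by simp [hz]))
          (by simp; linarith) (by simp; linarith) (Or.inr (by simp; linarith)) (by simp; omega)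
        simpa using this.le
      -- The equal sums leave no slack: what remains of a and of the shifted b coincides.
      · have ht : t = Multiset.replicate t.card (x + 1) :=
          Multiset.eq_replicate_card.2 fun z hz => hb1 z (by simp [hz])
        have hax' : ∀ z ∈ a, x + 1 ≤ z := fun z hz =>
          lt_of_le_of_ne (hax z (by simp [hz])) (fun h => hxa' (h ▸ hz))
        have hsa := Multiset.card_nsmul_le_sum hax'
        have hst : t.sum = t.card * (x + 1) := by
          rw [ht]; simp
        have hca : a.card = t.card := by omega
        rw [hca, smul_eq_mul] at hsa
        have hwv : w = v + 1 := by omega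
        have hsa' : a.sum = a.card * (x + 1) := by rw [hca]; omega
        have ha : a = t := by
          rw [ht, ← hca]
          refine Multiset.eq_replicate_card.2 fun z hz => ?_
          obtain ⟨a', rfl⟩ := Multiset.exists_cons_of_mem hz
          have h1 := Multiset.card_nsmul_le_sum (s := a') (a := x + 1)
            fun z hz => hax' z (by simp [hz])
          have h2 := hax' z hz
          simp only [Multiset.sum_cons, Multiset.card_cons, smul_eq_mul, add_mul] at h1 hsa'
          omega
        rw [ha, hwv]

end LegWeightSum

/-! ### Perron theory for A_α -/

section Perron

open Matrix

variable {V : Type*} [Fintype V] {G : SimpleGraph V} {α : ℝ}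

open Classical in
theorem alphaMatrix_mulVec_apply (G : SimpleGraph V) (α : ℝ) (x : V → ℝ) (v : V) :
    (alphaMatrix G α *ᵥ x) v = ∑ w, if G.Adj v w then α * x v + (1 - α) * x w else 0 := by
  simp only [alphaMatrix, add_mulVec, smul_mulVec, Pi.add_apply, Pi.smul_apply,
    SimpleGraph.degMatrix_mulVec_apply, SimpleGraph.adjMatrix_mulVec_apply, smul_eq_mul,
    ← Finset.sum_filter, Finset.sum_add_distrib, Finset.sum_const, nsmul_eq_mul, Finset.mul_sum,
    SimpleGraph.neighborFinset_eq_filter, ← SimpleGraph.card_neighborFinset_eq_degree]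
  ring

theorem alphaMatrix_apply_nonneg (h0 : 0 ≤ α) (h1 : α ≤ 1) (v w : V) :
    0 ≤ alphaMatrix G α v w := by
  classical
  simp only [alphaMatrix, SimpleGraph.degMatrix, Matrix.add_apply, Matrix.smul_apply, diagonal_apply,
    SimpleGraph.adjMatrix_apply, smul_eq_mul]
  have : 0 ≤ 1 - α := by linarith
  apply add_nonneg <;> apply mul_nonneg <;> first | assumption | (split_ifs <;> positivity)

open Classical in
theorem posSemidef_rhoAlpha_sub [Nonempty V] (G : SimpleGraph V) (α : ℝ) :
    (rhoAlpha α G • (1 : Matrix V V ℝ) - alphaMatrix G α).PosSemidef := by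
  have hH : (rhoAlpha α G • (1 : Matrix V V ℝ) - alphaMatrix G α).IsHermitian :=
    (isHermitian_one.smul (IsSelfAdjoint.all _)).sub (alphaMatrix_isHermitian G α)
  rw [hH.posSemidef_iff_eigenvalues_nonneg]
  intro i
  have hi : hH.eigenvalues i ∈ spectrum ℝ (rhoAlpha α G • (1 : Matrix V V ℝ) - alphaMatrix G α) := by
    rw [hH.spectrum_real_eq_range_eigenvalues]
    exact Set.mem_range_self i
  generalize hH.eigenvalues i = μ at hi ⊢
  rw [← Algebra.algebraMap_eq_smul_one, ← spectrum.singleton_sub_eq] at hi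
  obtain ⟨r, hr, s, hs, hrs⟩ := Set.mem_sub.1 hi
  rw [Set.mem_singleton_iff] at hr
  have := (isGreatest_rhoAlpha α G).2 hs
  simp only [Pi.zero_apply]
  linarith

/-- Perron's theorem for `A_α(G)`: the largest eigenvalue has a positive eigenvector. -/
theorem exists_pos_alphaMatrix_mulVec_eq (hG : G.Connected) (h0 : 0 ≤ α) (h1 : α < 1) :
    ∃ x : V → ℝ, (∀ v, 0 < x v) ∧ ∀ v, (alphaMatrix G α *ᵥ x) v = rhoAlpha α G * x v := by
  classical
  have := hG.nonempty
  have hmem := (isGreatest_rhoAlpha α G).1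
  rw [← Matrix.spectrum_toLin', ← Module.End.hasEigenvalue_iff_mem_spectrum] at hmem
  obtain ⟨y, hy⟩ := hmem.exists_hasEigenvector
  have hyA : alphaMatrix G α *ᵥ y = rhoAlpha α G • y := by simpa using hy.apply_eq_smul
  have hy0 : y ≠ 0 := hy.2
  have hP := posSemidef_rhoAlpha_sub G α
  have hmul : ∀ z : V → ℝ, (rhoAlpha α G • (1 : Matrix V V ℝ) - alphaMatrix G α) *ᵥ z
      = rhoAlpha α G • z - alphaMatrix G α *ᵥ z := by
    intro z
    rw [sub_mulVec, smul_mulVec, one_mulVec]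
  let x : V → ℝ := fun v => |y v|
  -- Nonnegative entries: replacing y by its absolute value cannot lower the quadratic form.
  have hle : y ⬝ᵥ alphaMatrix G α *ᵥ y ≤ x ⬝ᵥ alphaMatrix G α *ᵥ x := by
    simp only [dotProduct, mulVec, Finset.mul_sum]
    refine Finset.sum_le_sum fun v _ => Finset.sum_le_sum fun w _ => ?_
    calc y v * (alphaMatrix G α v w * y w) = alphaMatrix G α v w * (y v * y w) := by ring
      _ ≤ alphaMatrix G α v w * (|y v| * |y w|) := by
        rw [← abs_mul]
        exact mul_le_mul_of_nonneg_left (le_abs_self _) (alphaMatrix_apply_nonneg h0 h1.le v w)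
      _ = _ := by ring
  have hxx : x ⬝ᵥ x = y ⬝ᵥ y := by
    simp only [dotProduct, x, abs_mul_abs_self]
  have hzero : x ⬝ᵥ (rhoAlpha α G • (1 : Matrix V V ℝ) - alphaMatrix G α) *ᵥ x = 0 := by
    apply le_antisymm
    · rw [hmul, dotProduct_sub, dotProduct_smul, hxx]
      rw [hyA, dotProduct_smul] at hle
      linarith
    · simpa using hP.dotProduct_mulVec_nonneg x
  have hx : ∀ v, (alphaMatrix G α *ᵥ x) v = rhoAlpha α G * x v := by
    have := (hP.dotProduct_mulVec_zero_iff x).1 (by simpa using hzero)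
    rw [hmul, sub_eq_zero] at this
    intro v
    rw [← this]
    simp
  have hx0 : ∀ v, 0 ≤ x v := fun v => abs_nonneg _
  -- At a zero of x the eigenvalue equation is a vanishing sum of nonnegative terms, so zeros spread
  -- to neighbours.
  have hstep : ∀ v w, G.Adj v w → x v = 0 → x w = 0 := by
    intro v w hvw hv
    have h := hx v
    rw [alphaMatrix_mulVec_apply, hv, mul_zero, mul_zero,
      Finset.sum_eq_zero_iff_of_nonneg] at h
    · have := h w (Finset.mem_univ w)
      rw [if_pos hvw] at this
      have h1' : 1 - α ≠ 0 := by linarith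
      simpa [h1'] using this
    · intro w _
      have := hx0 w
      have : 0 ≤ 1 - α := by linarith
      split_ifs <;> positivity
  refine ⟨x, fun v => (hx0 v).lt_of_ne' fun hv => hy0 ?_, hx⟩
  have hall : ∀ w, x w = 0 := by
    intro w
    obtain ⟨p⟩ := hG.preconnected v w
    induction p with
    | nil => exact hv
    | cons h _ ih => exact ih (hstep _ _ h hv)
  funext w
  exact abs_eq_zero.1 (hall w)

theorem rhoAlpha_eq_of_iso {W : Type*} [Fintype W] {H : SimpleGraph W} (e : G ≃g H) (α : ℝ) :
    rhoAlpha α G = rhoAlpha α H := by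
  classical
  have h : alphaMatrix H α = Matrix.reindexAlgEquiv ℝ ℝ e.toEquiv (alphaMatrix G α) := by
    ext v w
    simp only [alphaMatrix, SimpleGraph.degMatrix, Matrix.add_apply, Matrix.smul_apply, diagonal_apply,
      SimpleGraph.adjMatrix_apply, coe_reindexAlgEquiv, reindex_apply, submatrix_apply]
    have hadj : G.Adj (e.toEquiv.symm v) (e.toEquiv.symm w) ↔ H.Adj v w := e.symm.map_adj_iff
    have hdeg : G.degree (e.toEquiv.symm v) = H.degree v := e.symm.degree_eq v
    simp [hadj, hdeg]
  unfold rhoAlpha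
  rw [h, AlgEquiv.spectrum_eq]

end Perron

/-! ### Positive solutions along one path -/

/-- A positive supersolution of the eigenvalue equation along a pendant path of length `N`. -/
theorem legValid_of_supersolution {β c : ℝ} {N : ℕ} {Z : ℕ → ℝ} (hZ : ∀ s ≤ N, 0 < Z s)
    (h0 : 0 < N → Z 1 ≤ (c + β) * Z 0) (h : ∀ s, s + 2 ≤ N → Z s + Z (s + 2) ≤ c * Z (s + 1)) :
    LegValid β c N ∧ (0 < N → legRatio β c N * Z N ≤ Z (N - 1)) := by
  have aux : ∀ s < N, Z (s + 1) ≤ (c - legRatio β c s) * Z s →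
      0 < c - legRatio β c s ∧ legRatio β c (s + 1) * Z (s + 1) ≤ Z s := by
    intro s hs h1
    have h2 : 0 < c - legRatio β c s :=
      pos_of_mul_pos_left ((hZ _ hs).trans_le h1) (hZ s hs.le).le
    refine ⟨h2, ?_⟩
    change (c - legRatio β c s)⁻¹ * _ ≤ _
    rwa [inv_mul_le_iff₀ h2]
  have key : ∀ s < N, 0 < c - legRatio β c s ∧ legRatio β c (s + 1) * Z (s + 1) ≤ Z s := by
    intro s hs
    refine aux s hs ?_
    induction s with
    | zero => simpa [legRatio] using h0 hs
    | succ s ih =>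
      have hs' : s < N := Nat.lt_of_succ_lt hs
      linarith [h s hs, (aux s hs' (ih hs')).2]
  refine ⟨fun s hs => (key s hs).1, fun hN => ?_⟩
  have := (key (N - 1) (by omega)).2
  rwa [Nat.sub_add_cancel hN] at this

/-- A positive solution of the eigenvalue equation along a pendant path of length `N`. -/
theorem legRatio_mul_eq_of_solution {β c : ℝ} {N : ℕ} {Z : ℕ → ℝ} (hZ : ∀ s ≤ N, 0 < Z s)
    (hN : 0 < N) (h0 : Z 1 = (c + β) * Z 0)
    (h : ∀ s, s + 2 ≤ N → Z s + Z (s + 2) = c * Z (s + 1)) :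
    legRatio β c N * Z N = Z (N - 1) := by
  have hv := (legValid_of_supersolution hZ (fun _ => h0.le) fun s hs => (h s hs).le).1
  have key : ∀ s < N, legRatio β c (s + 1) * Z (s + 1) = Z s := by
    intro s hs
    have h1 : Z (s + 1) = (c - legRatio β c s) * Z s := by
      induction s with
      | zero => simpa [legRatio] using h0
      | succ s ih =>
        have hs' : s < N := Nat.lt_of_succ_lt hs
        have h2 : legRatio β c (s + 1) * Z (s + 1) = Z s := by
          rw [ih hs']
          exact inv_mul_cancel_left₀ (hv s hs').ne' _
        linarith [h s hs]
    rw [h1]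
    exact inv_mul_cancel_left₀ (hv s hs).ne' _
  have := key (N - 1) (by omega)
  rwa [Nat.sub_add_cancel hN] at this

/-! ### Eliminating the pendant paths -/

section AttachPaths

open Matrix

variable {V : Type*} {G : SimpleGraph V} {u : V} {a : List ℕ} {α : ℝ}

theorem attachPaths_connected (hG : G.Connected) (u : V) (a : List ℕ) :
    (attachPaths G u a).Connected := by
  let f : G →g attachPaths G u a := ⟨Sum.inl, fun h => h⟩
  rw [SimpleGraph.connected_iff_exists_forall_reachable]
  refine ⟨Sum.inl u, ?_⟩
  rintro (v | ⟨i, j, hj⟩)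
  · exact (hG.preconnected u v).map f
  · induction j with
    | zero =>
      have : (attachPaths G u a).Adj (Sum.inl u) (Sum.inr ⟨i, 0, hj⟩) := ⟨rfl, rfl⟩
      exact this.reachable
    | succ j ih =>
      have hj' : j < a.get i := Nat.lt_of_succ_lt hj
      have : (attachPaths G u a).Adj (Sum.inr ⟨i, j, hj'⟩) (Sum.inr ⟨i, j + 1, hj⟩) :=
        ⟨rfl, Or.inl rfl⟩
      exact (ih hj').trans this.reachable

theorem Fin.sum_ite_val_succ_or (n : ℕ) (f : Fin n → ℝ) (j : Fin n) :
    (∑ k : Fin n, if (j : ℕ) + 1 = k ∨ (k : ℕ) + 1 = j then f k else 0)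
      = (if h : (j : ℕ) + 1 < n then f ⟨j + 1, h⟩ else 0)
        + (if 0 < (j : ℕ) then f ⟨j - 1, by omega⟩ else 0) := by
  have h1 : ∀ k : Fin n, (if (j : ℕ) + 1 = k ∨ (k : ℕ) + 1 = j then f k else 0)
      = (if (j : ℕ) + 1 = k then f k else 0) + (if (k : ℕ) + 1 = j then f k else 0) := by
    intro k
    by_cases h : (j : ℕ) + 1 = k
    · have : ¬ (k : ℕ) + 1 = j := by omega
      simp [h, this]
    · simp [h]
  simp only [h1, Finset.sum_add_distrib]
  congr 1
  · split_ifs with h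
    · rw [Finset.sum_eq_single ⟨j + 1, h⟩]
      · simp
      · intro k _ hk
        rw [if_neg]
        rintro h'
        exact hk (Fin.ext h'.symm)
      · simp
    · refine Finset.sum_eq_zero fun k _ => if_neg ?_
      omega
  · split_ifs with h
    · rw [Finset.sum_eq_single ⟨j - 1, by omega⟩]
      · rw [if_pos]
        simp only
        omega
      · intro k _ hk
        rw [if_neg]
        rintro h'
        exact hk (Fin.ext (by simp only; omega))
      · simp
    · refine Finset.sum_eq_zero fun k _ => if_neg ?_
      omega

/-- The values of a vector on `G(a, u)` along the `i`-th pendant path, read from the free end. -/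
def legValue (x : AttachVert V a → ℝ) (u : V) (i : Fin a.length) (s : ℕ) : ℝ :=
  -- The default is the value at the root, so s = `a.get i` continues the path to u.
  if h : s < a.get i then x (Sum.inr ⟨i, a.get i - 1 - s, by omega⟩) else x (Sum.inl u)

theorem legValue_length (x : AttachVert V a → ℝ) (u : V) (i : Fin a.length) :
    legValue x u i (a.get i) = x (Sum.inl u) := by
  simp [legValue]

theorem legValue_of_add_eq (x : AttachVert V a → ℝ) (u : V) (i : Fin a.length)
    (j : Fin (a.get i)) {s : ℕ} (hs : s + j + 1 = a.get i) :
    legValue x u i s = x (Sum.inr ⟨i, j⟩) := by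
  have h : s < a.get i := by omega
  have hj : a.get i - 1 - s = j := by omega
  simp only [legValue, dif_pos h, hj]

theorem legValue_pos {x : AttachVert V a → ℝ} (hx : ∀ p, 0 < x p) (u : V) (i : Fin a.length)
    (s : ℕ) : 0 < legValue x u i s := by
  unfold legValue
  split_ifs <;> exact hx _

variable [Fintype V]

open Classical in
theorem alphaMatrix_attachPaths_mulVec_inl (ha : ∀ k ∈ a, 0 < k) (x : AttachVert V a → ℝ) (v : V) :
    (alphaMatrix (attachPaths G u a) α *ᵥ x) (Sum.inl v)
      = (alphaMatrix G α *ᵥ (x ∘ Sum.inl)) v + if v = u then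
          ∑ i : Fin a.length, (α * x (Sum.inl u) + (1 - α) * legValue x u i (a.get i - 1)) else 0 := by
  rw [alphaMatrix_mulVec_apply, alphaMatrix_mulVec_apply, Fintype.sum_sum_type, Fintype.sum_sigma]
  congr 1
  by_cases hv : v = u
  · subst hv
    rw [if_pos rfl]
    refine Finset.sum_congr rfl fun i _ => ?_
    have hi : 0 < a.get i := ha _ (List.get_mem a i)
    rw [Finset.sum_eq_single ⟨0, hi⟩]
    · rw [if_pos ⟨rfl, rfl⟩, legValue_of_add_eq x v i ⟨0, hi⟩ (by simp only; omega)]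
    · intro j _ hj
      rw [if_neg]
      rintro ⟨_, h⟩
      exact hj (Fin.ext h)
    · simp
  · rw [if_neg hv]
    refine Finset.sum_eq_zero fun i _ => Finset.sum_eq_zero fun j _ => if_neg ?_
    rintro ⟨h, _⟩
    exact hv h

open Classical in
theorem alphaMatrix_attachPaths_mulVec_inr (x : AttachVert V a → ℝ) (i : Fin a.length)
    (j : Fin (a.get i)) {s : ℕ} (hs : s + j + 1 = a.get i) :
    (alphaMatrix (attachPaths G u a) α *ᵥ x) (Sum.inr ⟨i, j⟩)
      = (α * legValue x u i s + (1 - α) * legValue x u i (s + 1))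
        + if 0 < s then α * legValue x u i s + (1 - α) * legValue x u i (s - 1) else 0 := by
  rw [alphaMatrix_mulVec_apply, Fintype.sum_sum_type, Fintype.sum_sigma,
    Finset.sum_eq_single i, Finset.sum_eq_single u]
  rotate_left
  · intro v _ hv
    rw [if_neg]
    rintro ⟨h, _⟩
    exact hv h
  · simp
  · intro k _ hk
    refine Finset.sum_eq_zero fun l _ => if_neg ?_
    rintro ⟨h, _⟩
    exact hk h.symm
  · simp
  have h1 : ∀ k : Fin (a.get i), (attachPaths G u a).Adj (Sum.inr ⟨i, j⟩) (Sum.inr ⟨i, k⟩) ↔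
      ((j : ℕ) + 1 = k ∨ (k : ℕ) + 1 = j) := fun k =>
    ⟨fun h => h.2, fun h => ⟨rfl, h⟩⟩
  have h2 : (attachPaths G u a).Adj (Sum.inr ⟨i, j⟩) (Sum.inl u) ↔ (j : ℕ) = 0 :=
    ⟨fun h => h.2, fun h => ⟨rfl, h⟩⟩
  simp only [h1, h2]
  rw [Fin.sum_ite_val_succ_or, legValue_of_add_eq x u i j hs]
  have hfst : (if 0 < s then α * x (Sum.inr ⟨i, j⟩) + (1 - α) * legValue x u i (s - 1) else 0)
      = if h : (j : ℕ) + 1 < a.get i then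
          α * x (Sum.inr ⟨i, j⟩) + (1 - α) * x (Sum.inr ⟨i, ⟨j + 1, h⟩⟩) else 0 := by
    split_ifs with h3 h4 h4
    · rw [legValue_of_add_eq x u i ⟨j + 1, h4⟩ (by simp only; omega)]
    · omega
    · omega
    · rfl
  rw [hfst]
  by_cases hj : (j : ℕ) = 0
  · have : s + 1 = a.get i := by omega
    rw [this, legValue_length, if_pos hj, if_neg (by omega)]
    ring
  · rw [legValue_of_add_eq x u i ⟨j - 1, by omega⟩ (s := s + 1) (by simp only; omega), if_neg hj,
      if_pos (by omega)]
    ring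

theorem sum_legWeight_get (β c : ℝ) (a : List ℕ) :
    ∑ i : Fin a.length, legWeight β c (a.get i) = ((a : Multiset ℕ).map (legWeight β c)).sum := by
  rw [Multiset.map_coe, Multiset.sum_coe, ← Fin.sum_univ_fun_getElem]
  rfl

open Classical in
/-- A positive supersolution of the eigenvalue equation on `G(a, u)` restricts to one on `G` with
the paths replaced by a diagonal term at `u`. -/
theorem supersolution_restrict (hα1 : α < 1) (ha : ∀ k ∈ a, 0 < k) {ρ β c : ℝ}
    (hβ : (1 - α) * β = α) (hc : (1 - α) * c = ρ - 2 * α)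
    {x : AttachVert V a → ℝ} (hx : ∀ p, 0 < x p)
    (hAx : ∀ p, (alphaMatrix (attachPaths G u a) α *ᵥ x) p ≤ ρ * x p) :
    (∀ k ∈ a, LegValid β c k) ∧
    ∀ v, (alphaMatrix G α *ᵥ (x ∘ Sum.inl)) v + (if v = u then
      (1 - α) * ((a : Multiset ℕ).map (legWeight β c)).sum * x (Sum.inl v) else 0)
        ≤ ρ * x (Sum.inl v) := by
  have h1 : 0 < 1 - α := by linarith
  have hleg : ∀ i : Fin a.length, LegValid β c (a.get i) ∧
      legRatio β c (a.get i) * x (Sum.inl u) ≤ legValue x u i (a.get i - 1) := by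
    intro i
    have hi : 0 < a.get i := ha _ (List.get_mem a i)
    have hsuper := legValid_of_supersolution (β := β) (c := c) (N := a.get i)
      (Z := legValue x u i) (fun s _ => legValue_pos hx u i s) ?_ ?_
    · rw [legValue_length] at hsuper
      exact ⟨hsuper.1, hsuper.2 hi⟩
    · intro _
      have hs : 0 + (⟨a.get i - 1, by omega⟩ : Fin (a.get i)).1 + 1 = a.get i := by
        simp only; omega
      have h := hAx (Sum.inr ⟨i, ⟨a.get i - 1, by omega⟩⟩)
      rw [alphaMatrix_attachPaths_mulVec_inr x i _ hs, ← legValue_of_add_eq x u i _ hs] at h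
      simp only [lt_irrefl, if_false] at h
      refine le_of_mul_le_mul_left ?_ h1
      linear_combination h - legValue x u i 0 * (hc + hβ)
    · intro s hs2
      have hs : s + 1 + (⟨a.get i - 2 - s, by omega⟩ : Fin (a.get i)).1 + 1 = a.get i := by
        simp only; omega
      have h := hAx (Sum.inr ⟨i, ⟨a.get i - 2 - s, by omega⟩⟩)
      rw [alphaMatrix_attachPaths_mulVec_inr x i _ hs, ← legValue_of_add_eq x u i _ hs] at h
      simp only [Nat.succ_pos, if_true, Nat.add_sub_cancel] at h
      refine le_of_mul_le_mul_left ?_ h1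
      linear_combination h - legValue x u i (s + 1) * hc
  refine ⟨fun k hk => ?_, fun v => le_trans ?_ (hAx (Sum.inl v))⟩
  · obtain ⟨i, rfl⟩ := List.mem_iff_get.1 hk
    exact (hleg i).1
  · rw [alphaMatrix_attachPaths_mulVec_inl ha]
    gcongr
    split_ifs with hv
    · subst hv
      rw [← sum_legWeight_get, Finset.mul_sum, Finset.sum_mul]
      refine Finset.sum_le_sum fun i _ => ?_
      have := mul_le_mul_of_nonneg_left (hleg i).2 h1.le
      unfold legWeight
      linear_combination this + x (Sum.inl v) * hβ
    · exact le_rfl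

open Classical in
/-- A positive solution of the eigenvalue equation on `G(a, u)` restricts to one on `G` with
the paths replaced by a diagonal term at `u`. -/
theorem solution_restrict (hα1 : α < 1) (ha : ∀ k ∈ a, 0 < k) {ρ β c : ℝ}
    (hβ : (1 - α) * β = α) (hc : (1 - α) * c = ρ - 2 * α)
    {x : AttachVert V a → ℝ} (hx : ∀ p, 0 < x p)
    (hAx : ∀ p, (alphaMatrix (attachPaths G u a) α *ᵥ x) p = ρ * x p) (v : V) :
    (alphaMatrix G α *ᵥ (x ∘ Sum.inl)) v + (if v = u then
      (1 - α) * ((a : Multiset ℕ).map (legWeight β c)).sum * x (Sum.inl v) else 0)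
        = ρ * x (Sum.inl v) := by
  have h1 : 0 < 1 - α := by linarith
  have hleg : ∀ i : Fin a.length,
      legRatio β c (a.get i) * x (Sum.inl u) = legValue x u i (a.get i - 1) := by
    intro i
    have hi : 0 < a.get i := ha _ (List.get_mem a i)
    have hsol := legRatio_mul_eq_of_solution (β := β) (c := c) (N := a.get i)
      (Z := legValue x u i) (fun s _ => legValue_pos hx u i s) hi ?_ ?_
    · rwa [legValue_length] at hsol
    · have hs : 0 + (⟨a.get i - 1, by omega⟩ : Fin (a.get i)).1 + 1 = a.get i := by
        simp only; omega
      have h := hAx (Sum.inr ⟨i, ⟨a.get i - 1, by omega⟩⟩)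
      rw [alphaMatrix_attachPaths_mulVec_inr x i _ hs, ← legValue_of_add_eq x u i _ hs] at h
      simp only [lt_irrefl, if_false] at h
      refine mul_left_cancel₀ h1.ne' ?_
      linear_combination h - legValue x u i 0 * (hc + hβ)
    · intro s hs2
      have hs : s + 1 + (⟨a.get i - 2 - s, by omega⟩ : Fin (a.get i)).1 + 1 = a.get i := by
        simp only; omega
      have h := hAx (Sum.inr ⟨i, ⟨a.get i - 2 - s, by omega⟩⟩)
      rw [alphaMatrix_attachPaths_mulVec_inr x i _ hs, ← legValue_of_add_eq x u i _ hs] at h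
      simp only [Nat.succ_pos, if_true, Nat.add_sub_cancel] at h
      refine mul_left_cancel₀ h1.ne' ?_
      linear_combination h - legValue x u i (s + 1) * hc
  rw [← hAx (Sum.inl v), alphaMatrix_attachPaths_mulVec_inl ha]
  congr 1
  split_ifs with hv
  · subst hv
    rw [← sum_legWeight_get, Finset.mul_sum, Finset.sum_mul]
    refine Finset.sum_congr rfl fun i _ => ?_
    rw [← hleg i]
    unfold legWeight
    linear_combination x (Sum.inl v) * hβ
  · rfl

end AttachPaths

/-! ### Reduction of shortlex order to a comparison of minima -/

theorem List.Lex.exists_append_cons {a b : List ℕ} (h : List.Lex (· < ·) a b)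
    (hl : a.length = b.length) :
    ∃ l x a' y b', a = l ++ x :: a' ∧ b = l ++ y :: b' ∧ x < y := by
  induction h with
  | nil => simp at hl
  | rel h => exact ⟨[], _, _, _, _, rfl, rfl, h⟩
  | @cons z a b _ ih =>
    obtain ⟨l, x, a', y, b', rfl, rfl, hxy⟩ := ih (by simpa using hl)
    exact ⟨z :: l, x, a', y, b', rfl, rfl, hxy⟩

/-- After padding the shorter partition with zeros and cancelling a common part, the partition that
comes first in shortlex order has the smaller minimum. -/
theorem IsPartition.exists_common_part {n : ℕ} {a b : List ℕ} (ha : IsPartition n a)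
    (hb : IsPartition n b) (hab : List.Shortlex (· < ·) a b) :
    ∃ (z x : ℕ) (C A B : Multiset ℕ), (a : Multiset ℕ) + Multiset.replicate z 0 = C + A ∧
      (b : Multiset ℕ) = C + B ∧ A.card = B.card ∧ x ∈ A ∧ (∀ y ∈ A, x ≤ y) ∧ ∀ y ∈ B, x < y := by
  rcases List.shortlex_def.1 hab with hlt | ⟨hl, hlex⟩
  · refine ⟨b.length - a.length, 0, 0, (a : Multiset ℕ) + Multiset.replicate (b.length - a.length) 0,
      b,      (zero_add _).symm, (zero_add _).symm, ?_, ?_, fun _ _ => Nat.zero_le _, hb.2.1⟩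
    · simp; omega
    · rw [Multiset.mem_add, Multiset.mem_replicate]
      exact Or.inr ⟨by omega, rfl⟩
  · obtain ⟨l, x, a', y, b', rfl, rfl, hxy⟩ := hlex.exists_append_cons hl
    refine ⟨0, x, l, (x :: a' : List ℕ), (y :: b' : List ℕ), by simp, by simp, ?_, by simp, ?_, ?_⟩
    · simpa using hl
    · have h := (List.pairwise_append.1 ha.1).2.1
      intro w hw
      rcases List.mem_cons.1 (Multiset.mem_coe.1 hw) with rfl | hw
      · exact le_rfl
      · exact List.rel_of_pairwise_cons h hw
    · have h := (List.pairwise_append.1 hb.1).2.1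
      intro w hw
      rcases List.mem_cons.1 (Multiset.mem_coe.1 hw) with rfl | hw
      · exact hxy
      · exact hxy.trans_le (List.rel_of_pairwise_cons h hw)

/-! ### Comparison of spectral radii -/

section Comparison

open Matrix

variable {V : Type*} [Fintype V] {G : SimpleGraph V} {u : V} {α : ℝ}

/-- The terms of A_α(G) x at u are nonnegative and can be dropped, leaving F ≤ ρ/(1-α) = c + 2β. If
G has another vertex, u has a neighbour and the dropped sum is positive. -/
theorem le_of_alphaMatrix_mulVec_add_le (hG : G.Connected) (hα0 : 0 ≤ α) (hα1 : α < 1)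
    {ρ β c F : ℝ} (hβ : (1 - α) * β = α) (hc : (1 - α) * c = ρ - 2 * α) {x : V → ℝ}
    (hx : ∀ v, 0 < x v) (h : (alphaMatrix G α *ᵥ x) u + (1 - α) * F * x u ≤ ρ * x u) :
    F ≤ c + 2 * β ∧ (Fintype.card V ≠ 1 → F < c + 2 * β) := by
  classical
  have h1 : 0 < 1 - α := by linarith
  have hρ : ρ = (1 - α) * (c + 2 * β) := by linear_combination -hc - 2 * hβ
  have hterm : ∀ w, 0 ≤ if G.Adj u w then α * x u + (1 - α) * x w else 0 := by
    intro w
    have := hx u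
    have := hx w
    split_ifs <;> positivity
  rw [alphaMatrix_mulVec_apply, hρ] at h
  constructor
  · have h0 := Finset.sum_nonneg fun w (_ : w ∈ Finset.univ) => hterm w
    have h2 : (1 - α) * x u * F ≤ (1 - α) * x u * (c + 2 * β) := by linarith
    exact le_of_mul_le_mul_left h2 (mul_pos h1 (hx u))
  · intro hV
    have : Nonempty V := ⟨u⟩
    have : Nontrivial V := by
      rw [← Fintype.one_lt_card_iff_nontrivial]
      have := Fintype.card_pos (α := V)
      omega
    obtain ⟨w, hw⟩ := (SimpleGraph.degree_pos_iff_exists_adj (G := G) (v := u)).1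
      (hG.preconnected.degree_pos_of_nontrivial u)
    have h0 := Finset.sum_pos' (fun w (_ : w ∈ Finset.univ) => hterm w) ⟨w, Finset.mem_univ w, by
      have := hx u
      have := hx w
      rw [if_pos hw]
      positivity⟩
    have h2 : (1 - α) * x u * F < (1 - α) * x u * (c + 2 * β) := by linarith
    exact lt_of_mul_lt_mul_left h2 (mul_pos h1 (hx u)).le

open Classical in
/-- Comparison of a positive solution and a positive supersolution which differ in the diagonal
term at `u`. -/
theorem le_of_solution_of_supersolution {ρ p q : ℝ} {x z : V → ℝ} (hx : ∀ v, 0 < x v)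
    (hz : ∀ v, 0 < z v)
    (hsol : ∀ v, (alphaMatrix G α *ᵥ x) v + (if v = u then p * x v else 0) = ρ * x v)
    (hsuper : ∀ v, (alphaMatrix G α *ᵥ z) v + (if v = u then q * z v else 0) ≤ ρ * z v) :
    q ≤ p := by
  have hsymm : z ⬝ᵥ alphaMatrix G α *ᵥ x = x ⬝ᵥ alphaMatrix G α *ᵥ z := by
    have hT : (alphaMatrix G α)ᵀ = alphaMatrix G α := by
      have := alphaMatrix_isHermitian G α
      rwa [IsHermitian, conjTranspose_eq_transpose_of_trivial] at this
    rw [dotProduct_mulVec, ← mulVec_transpose, hT, dotProduct_comm]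
  have h1 : ∑ v, z v * ((alphaMatrix G α *ᵥ x) v + (if v = u then p * x v else 0))
      = ∑ v, z v * (ρ * x v) := Finset.sum_congr rfl fun v _ => by rw [hsol v]
  have h2 : ∑ v, x v * ((alphaMatrix G α *ᵥ z) v + (if v = u then q * z v else 0))
      ≤ ∑ v, x v * (ρ * z v) :=
    Finset.sum_le_sum fun v _ => mul_le_mul_of_nonneg_left (hsuper v) (hx v).le
  have h3 : ∑ v, z v * (ρ * x v) = ∑ v, x v * (ρ * z v) :=
    Finset.sum_congr rfl fun v _ => by ring
  simp only [mul_add, Finset.sum_add_distrib, mul_ite, mul_zero, Finset.sum_ite_eq',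
    Finset.mem_univ, if_true] at h1 h2
  simp only [dotProduct] at hsymm
  have h4 : x u * z u * q ≤ x u * z u * p := by linarith
  exact le_of_mul_le_mul_left h4 (mul_pos (hx u) (hz u))

theorem rhoAlpha_attachPaths_lt (hG : G.Connected) (u : V) {n : ℕ} {a b : List ℕ}
    (ha : IsPartition n a) (hb : IsPartition n b) (hab : List.Shortlex (· < ·) a b)
    (hα0 : 0 ≤ α) (hα1 : α < 1) (hex : ¬ (Fintype.card V = 1 ∧ b.length = 2)) :
    rhoAlpha α (attachPaths G u a) < rhoAlpha α (attachPaths G u b) := by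
  classical
  by_contra hcon
  push Not at hcon
  obtain ⟨x, hx, hAx⟩ := exists_pos_alphaMatrix_mulVec_eq (attachPaths_connected hG u a) hα0 hα1
  obtain ⟨z, hz, hAz⟩ := exists_pos_alphaMatrix_mulVec_eq (attachPaths_connected hG u b) hα0 hα1
  -- The Perron vector for b becomes a supersolution at the larger value belonging to a.
  have hAz' : ∀ p, (alphaMatrix (attachPaths G u b) α *ᵥ z) p
      ≤ rhoAlpha α (attachPaths G u a) * z p := fun p =>
    (hAz p).le.trans (mul_le_mul_of_nonneg_right hcon (hz p).le)
  generalize rhoAlpha α (attachPaths G u a) = ρ at *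
  have h1 : 0 < 1 - α := by linarith
  obtain ⟨β, hβ⟩ : ∃ β, (1 - α) * β = α := ⟨α / (1 - α), mul_div_cancel₀ _ h1.ne'⟩
  obtain ⟨c, hc⟩ : ∃ c, (1 - α) * c = ρ - 2 * α :=
    ⟨(ρ - 2 * α) / (1 - α), mul_div_cancel₀ _ h1.ne'⟩
  have hβ0 : 0 ≤ β := by
    rw [← hβ] at hα0
    exact nonneg_of_mul_nonneg_right hα0 h1
  obtain ⟨hva, hsa⟩ := supersolution_restrict hα1 ha.2.1 hβ hc hx fun p => (hAx p).le
  obtain ⟨hvb, hsb⟩ := supersolution_restrict hα1 hb.2.1 hβ hc hz hAz'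
  have hle := le_of_solution_of_supersolution (fun v => hx (Sum.inl v)) (fun v => hz (Sum.inl v))
    (solution_restrict hα1 ha.2.1 hβ hc hx hAx) hsb
  replace hle := le_of_mul_le_mul_left hle h1
  have hFa := (le_of_alphaMatrix_mulVec_add_le hG hα0 hα1 hβ hc (x := x ∘ Sum.inl)
    (fun v => hx (Sum.inl v)) (by simpa only [if_true, Function.comp_apply] using hsa u)).1
  obtain ⟨hFb, hFb'⟩ := le_of_alphaMatrix_mulVec_add_le hG hα0 hα1 hβ hc (x := z ∘ Sum.inl)
    (fun v => hz (Sum.inl v)) (by simpa only [if_true, Function.comp_apply] using hsb u)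
  obtain ⟨k, y, C, A, B, hCA, hCB, hcard, hyA, hA, hB⟩ := ha.exists_common_part hb hab
  have hsum : A.sum = B.sum := by
    have e1 := congrArg Multiset.sum hCA
    have e2 := congrArg Multiset.sum hCB
    simp only [Multiset.sum_add, Multiset.sum_coe, Multiset.sum_replicate, smul_zero, add_zero,
      ha.2.2, hb.2.2] at e1 e2
    omega
  have eA : ((a : Multiset ℕ).map (legWeight β c)).sum
      = (C.map (legWeight β c)).sum + (A.map (legWeight β c)).sum := by
    have := congrArg (fun s : Multiset ℕ => (s.map (legWeight β c)).sum) hCA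
    simpa only [Multiset.map_add, Multiset.sum_add, Multiset.map_replicate, legWeight_zero,
      Multiset.sum_replicate, smul_zero, add_zero] using this
  have eB : ((b : Multiset ℕ).map (legWeight β c)).sum
      = (C.map (legWeight β c)).sum + (B.map (legWeight β c)).sum := by
    rw [hCB, Multiset.map_add, Multiset.sum_add]
  have hmemb : ∀ w ∈ C + B, w ∈ b := fun w hw => by
    rw [← hCB] at hw
    exact hw
  have hvC : ∀ w ∈ C, LegValid β c w := fun w hw =>
    hvb w (hmemb w (Multiset.mem_add.2 (Or.inl hw)))
  have hC0 := sum_legWeight_nonneg hβ0 hvC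
  have hlt := sum_legWeight_lt hβ0 hcard hsum hyA hA hB (fun w hw => by
      have h2 : w ∈ (a : Multiset ℕ) + Multiset.replicate k 0 := by
        rw [hCA]
        exact Multiset.mem_add.2 (Or.inr hw)
      rcases Multiset.mem_add.1 h2 with h2 | h2
      · exact hva w h2
      · rw [Multiset.eq_of_mem_replicate h2]
        exact fun s hs => absurd hs (Nat.not_lt_zero s))
    (fun w hw => hvb w (hmemb w (Multiset.mem_add.2 (Or.inr hw))))
    (by linarith) (by linarith) ?_
  · linarith
  -- Slack comes from a neighbour of u, from a cancelled common path, or from b having at least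
  -- three parts.
  · by_cases hV : Fintype.card V = 1
    · rcases C.empty_or_exists_mem with rfl | ⟨w, hw⟩
      · left
        rw [zero_add] at hCB
        have hlen : B.card = b.length := by rw [← hCB, Multiset.coe_card]
        have hb2 : b.length ≠ 2 := fun h => hex ⟨hV, h⟩
        have hA1 : 0 < A.card := Multiset.card_pos_iff_exists_mem.2 ⟨y, hyA⟩
        have hB1 : B.card ≠ 1 := by
          intro hB1
          obtain ⟨r, rfl⟩ := Multiset.card_eq_one.1 hB1
          obtain ⟨s, rfl⟩ := Multiset.card_eq_one.1 (hcard.trans hB1)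
          have := hB r (by simp)
          simp only [Multiset.mem_singleton, Multiset.sum_singleton] at hyA hsum
          omega
        omega
      · right
        have := sum_legWeight_pos hβ0 hvC hw
          (hb.2.1 w (hmemb w (Multiset.mem_add.2 (Or.inl hw))))
        linarith
    · right
      linarith [hFb' hV]

end Comparison

/-! ### The exceptional case: paths -/

section PathIso

theorem nonempty_iso_pathGraph {W : Type*} [Fintype W] {H : SimpleGraph W} {n : ℕ}
    (hcard : Fintype.card W = n + 1) (f : W → ℕ) (hf : Function.Injective f)
    (hn : ∀ w, f w < n + 1) (hadj : ∀ v w, H.Adj v w ↔ f v + 1 = f w ∨ f w + 1 = f v) :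
    Nonempty (H ≃g SimpleGraph.pathGraph (n + 1)) := by
  let g : W → Fin (n + 1) := fun w => ⟨f w, hn w⟩
  have hg : Function.Bijective g := by
    rw [Fintype.bijective_iff_injective_and_card]
    exact ⟨fun v w h => hf (congrArg Fin.val h), by simp [hcard]⟩
  refine ⟨⟨Equiv.ofBijective g hg, ?_⟩⟩
  intro v w
  rw [hadj, SimpleGraph.pathGraph_adj]
  rfl

theorem card_attachVert {V : Type*} [Fintype V] (a : List ℕ) :
    Fintype.card (AttachVert V a) = Fintype.card V + a.sum := by
  rw [Fintype.card_sum, Fintype.card_sigma]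
  simp only [Fintype.card_fin]
  congr 1
  exact Fin.sum_univ_getElem a

/-- Attaching one or two pendant paths to a single vertex gives a path. -/
theorem attachPaths_iso_pathGraph {V : Type*} [Fintype V] (hV : Fintype.card V = 1)
    (G : SimpleGraph V) (u : V) {a : List ℕ} (ha : ∀ k ∈ a, 0 < k) (hl : a.length = 1 ∨ a.length = 2) :
    Nonempty (attachPaths G u a ≃g SimpleGraph.pathGraph (a.sum + 1)) := by
  have hsub : Subsingleton V := Fintype.card_le_one_iff_subsingleton.1 hV.le
  have hc : Fintype.card (AttachVert V a) = a.sum + 1 := by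
    rw [card_attachVert, hV, add_comm]
  -- Positions along the path: the root sits at `a.headI`, the first leg runs down to 0 and the
  -- second runs upwards.
  let f : AttachVert V a → ℕ := Sum.elim (fun _ => a.headI)
    (fun p => if (p.1 : ℕ) = 0 then a.headI - 1 - p.2 else a.headI + 1 + p.2)
  have hG : ∀ v w, ¬ G.Adj v w := fun v w h => h.ne (Subsingleton.elim v w)
  have hu : ∀ v, v = u := fun v => Subsingleton.elim v u
  have hlen : ∀ i : Fin a.length, ((i : ℕ) = 0 ∧ a.get i = a.headI) ∨
      ((i : ℕ) = 1 ∧ a.headI + a.get i = a.sum) := by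
    intro i
    match a, hl, i with
    | [x], _, ⟨0, _⟩ => simp
    | [x, y], _, ⟨0, _⟩ => simp
    | [x, y], _, ⟨1, _⟩ => simp
  have hhead : 0 < a.headI ∧ a.headI ≤ a.sum := by
    match a, hl with
    | [x], _ => simpa using ha
    | [x, y], _ => simpa using (ha x (by simp))
  refine nonempty_iso_pathGraph hc f ?_ ?_ ?_
  · rintro (v | ⟨i, j⟩) (w | ⟨k, l⟩) h
    · rw [Subsingleton.elim v w]
    · exfalso
      have := l.2
      rcases hlen k with ⟨h1, h2⟩ | ⟨h1, h2⟩ <;> simp [f, h1] at h <;> omega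
    · exfalso
      have := j.2
      rcases hlen i with ⟨h1, h2⟩ | ⟨h1, h2⟩ <;> simp [f, h1] at h <;> omega
    · have hj := j.2
      have hl' := l.2
      have : i = k ∧ (j : ℕ) = l := by
        rw [Fin.ext_iff]
        rcases hlen i with ⟨h1, h2⟩ | ⟨h1, h2⟩ <;> rcases hlen k with ⟨h3, h4⟩ | ⟨h3, h4⟩ <;>
          simp [f, h1, h3] at h <;> omega
      obtain ⟨rfl, h5⟩ := this
      rw [Fin.ext h5]
  · rintro (v | ⟨i, j⟩)
    · simp only [f, Sum.elim_inl]
      omega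
    · have := j.2
      rcases hlen i with ⟨h1, h2⟩ | ⟨h1, h2⟩ <;> simp [f, h1] <;> omega
  · rintro (v | ⟨i, j⟩) (w | ⟨k, l⟩)
    · simp [attachPaths, AttachAdj, hG, f]
    · have := l.2
      simp only [attachPaths, AttachAdj, hu, true_and]
      rcases hlen k with ⟨h1, h2⟩ | ⟨h1, h2⟩ <;> simp [f, h1] <;> omega
    · have := j.2
      simp only [attachPaths, AttachAdj, hu, true_and]
      rcases hlen i with ⟨h1, h2⟩ | ⟨h1, h2⟩ <;> simp [f, h1] <;> omega
    · have := j.2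
      have := l.2
      simp only [attachPaths, AttachAdj]
      rw [Fin.ext_iff]
      rcases hlen i with ⟨h1, h2⟩ | ⟨h1, h2⟩ <;> rcases hlen k with ⟨h3, h4⟩ | ⟨h3, h4⟩ <;>
        simp [f, h1, h3] <;> omega

end PathIso

theorem theorem2 {V : Type*} [Fintype V] (G : SimpleGraph V) (hG : G.Connected) (u : V)
    (n : ℕ) (a b : List ℕ) (ha : IsPartition n a) (hb : IsPartition n b)
    (hab : List.Shortlex (· < ·) a b) (α : ℝ) (hα0 : 0 ≤ α) (hα1 : α < 1) :
    rhoAlpha α (attachPaths G u a) ≤ rhoAlpha α (attachPaths G u b) ∧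
    (rhoAlpha α (attachPaths G u a) = rhoAlpha α (attachPaths G u b) ↔
      Nonempty (attachPaths G u a ≃g attachPaths G u b)) ∧
    (Nonempty (attachPaths G u a ≃g attachPaths G u b) ↔
      Fintype.card V = 1 ∧ b.length = 2) := by
  have hρ : Nonempty (attachPaths G u a ≃g attachPaths G u b) →
      rhoAlpha α (attachPaths G u a) = rhoAlpha α (attachPaths G u b) :=
    fun ⟨e⟩ => rhoAlpha_eq_of_iso e α
  by_cases hex : Fintype.card V = 1 ∧ b.length = 2
  · obtain ⟨hV, hb2⟩ := hex
    have hla : a.length = 1 ∨ a.length = 2 := by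
      have hle : a.length ≤ b.length := by
        rcases List.shortlex_def.1 hab with h | h
        · exact h.le
        · exact h.1.le
      have ha0 : a ≠ [] := by
        rintro rfl
        have hn : n = 0 := by simpa using ha.2.2.symm
        obtain ⟨y, hy⟩ := List.exists_mem_of_length_pos (show 0 < b.length by omega)
        have h1 := hb.2.1 y hy
        have h2 := List.le_sum_of_mem hy
        have h3 := hb.2.2
        omega
      have := List.length_pos_iff.2 ha0
      omega
    have hiso : Nonempty (attachPaths G u a ≃g attachPaths G u b) := by
      obtain ⟨e⟩ := attachPaths_iso_pathGraph hV G u ha.2.1 hla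
      obtain ⟨e'⟩ := attachPaths_iso_pathGraph hV G u hb.2.1 (Or.inr hb2)
      rw [ha.2.2] at e
      rw [hb.2.2] at e'
      exact ⟨e.trans e'.symm⟩
    exact ⟨(hρ hiso).le, ⟨fun _ => hiso, hρ⟩, ⟨fun _ => ⟨hV, hb2⟩, fun _ => hiso⟩⟩
  · have hlt := rhoAlpha_attachPaths_lt hG u ha hb hab hα0 hα1 hex
    exact ⟨hlt.le, ⟨fun h => absurd h hlt.ne, hρ⟩,
      ⟨fun h => absurd (hρ h) hlt.ne, fun h => absurd h hex⟩⟩
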